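/- Let $Q=[a,b]\subset\mathbb R$ be a bounded nondegenerate interval and write $\langle f\rangle_J=\frac1{|J|}\int_J f$. A weight is an almost everywhere positive function. A weight $w$ belongs to $A_\infty(Q)$ if $w$ and $\log w$ are integrable on $Q$ and $$[w]_{A_\infty(Q)}:=\sup_{J}\,\langle w\rangle_J\,e^{-\langle\log w\rangle_J}<\infty,$$ where the supremum is over all nondegenerate subintervals $J$ of $Q$. For $C\ge1$ let $A_\infty^C(Q)=\{w\in A_\infty(Q):[w]_{A_\infty(Q)}\le C\}$, and let $\xi^+=\xi^+(C)$ be the unique solution in $[0,1)$ of the equation $e^{-\xi}=C(1-\xi)$. **Theorem.** Let $C\ge1$ and $1\le\delta<1/\xi^+(C)$ (any $\delta\ge1$ is allowed if $C=1$, when $\xi^+=0$). If $e^{\varphi}\in A_\infty^C(Q)$, then $e^{\delta\varphi}\in A_\infty(Q)$ and $$[e^{\delta\varphi}]_{A_\infty(Q)}\le\frac{e^{-\delta\xi^+}}{1-\delta\xi^+}.$$ This estimate is sharp: for all such $C$, $\delta$ and $Q$ there is a function $\varphi$ with $e^\varphi\in A^C_\infty(Q)$ for which equality holds. The range of $\delta$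 is sharp as well: if $\delta\ge 1$ and $\delta\,\xi^+(C)\ge1$, then there is a function $\varphi$ with $e^\varphi\in A_\infty^C(Q)$ and $e^{\delta\varphi}\notin A_\infty(Q)$. -/

import Mathlib

open MeasureTheory Set
open scoped ENNReal

/-- The equation `e^{-ξ} = C (1 - ξ)` has exactly one solution with `0 ≤ ξ < 1` when `C ≥ 1`. -/
theorem existsUnique_xiPlus {C : ℝ} (hC : 1 ≤ C) :
    ∃! ξ : ℝ, 0 ≤ ξ ∧ ξ < 1 ∧ Real.exp (-ξ) = C * (1 - ξ) := by
  have key : ∀ x y : ℝ, 0 ≤ x → x < y → y < 1 → Real.exp (-x) = C * (1 - x) →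
      Real.exp (-y) = C * (1 - y) → False := by
    intro x y hx hxy hy ex ey
    have h1 : -(y - x) + 1 < Real.exp (-(y - x)) := Real.add_one_lt_exp (by linarith)
    have h2 : Real.exp (-y) = Real.exp (-x) * Real.exp (-(y - x)) := by
      rw [← Real.exp_add]; congr 1; ring
    have hpos : 0 < C * (1 - x) := mul_pos (by linarith) (by linarith)
    have h3 := mul_lt_mul_of_pos_left h1 hpos
    rw [ex, ey] at h2
    have h4 : 0 ≤ C * (x * (y - x)) :=
      mul_nonneg (by linarith) (mul_nonneg hx (by linarith))
    nlinarith
  have hcont : ContinuousOn (fun x : ℝ => Real.exp (-x) - C * (1 - x)) (Icc 0 1) := by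
    fun_prop
  obtain ⟨ξ, hξ, h0⟩ : (0 : ℝ) ∈ (fun x : ℝ => Real.exp (-x) - C * (1 - x)) '' Icc 0 1 := by
    apply intermediate_value_Icc zero_le_one hcont
    constructor
    · simpa using hC
    · simpa using (Real.exp_pos (-1)).le
  have hsol : Real.exp (-ξ) = C * (1 - ξ) := by
    have : Real.exp (-ξ) - C * (1 - ξ) = 0 := h0
    linarith
  have hlt : ξ < 1 := by
    rcases lt_or_eq_of_le hξ.2 with h | h
    · exact h
    · exfalso
      rw [h] at hsol
      have := Real.exp_pos (-1)
      rw [hsol] at this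
      simp at this
  refine ⟨ξ, ⟨hξ.1, hlt, hsol⟩, ?_⟩
  rintro y ⟨hy0, hy1, hy⟩
  rcases lt_trichotomy y ξ with h | h | h
  · exact (key y ξ hy0 h hlt hy hsol).elim
  · exact h
  · exact (key ξ y hξ.1 h hy1 hsol hy).elim

/-- `ξ⁺(C)`: the unique solution in `[0, 1)` of `e^{-ξ} = C (1 - ξ)`, for `C ≥ 1`. -/
noncomputable def xiPlus (C : ℝ) (hC : 1 ≤ C) : ℝ := (existsUnique_xiPlus hC).choose

theorem xiPlus_spec (C : ℝ) (hC : 1 ≤ C) :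
    0 ≤ xiPlus C hC ∧ xiPlus C hC < 1 ∧
      Real.exp (-xiPlus C hC) = C * (1 - xiPlus C hC) :=
  (existsUnique_xiPlus hC).choose_spec.1

/-- The `A_∞`-characteristic of `w` on the interval `Q = [a, b]`: the supremum, over all
nondegenerate subintervals `J = [c, d]` of `Q`, of `⟨w⟩_J * exp (-⟨log w⟩_J)`, as an element
of `[0, ∞]`. It is meaningful when `w` and `log w` are integrable on `Q`. -/
noncomputable def ainfChar (w : ℝ → ℝ) (a b : ℝ) : ℝ≥0∞ :=
  ⨆ (c : ℝ) (d : ℝ) (_ : a ≤ c ∧ c < d ∧ d ≤ b),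
    ENNReal.ofReal
      ((⨍ t in Icc c d, w t) * Real.exp (-(⨍ t in Icc c d, Real.log (w t))))

/-- `w ∈ A_∞(Q)` for `Q = [a, b]`: `w` is positive almost everywhere on `Q`, `w` and `log w` are
integrable on `Q` (for the compact interval `Q` this is the same as locally integrable), and the
`A_∞`-characteristic of `w` on `Q` is finite. -/
structure MemAinf (w : ℝ → ℝ) (a b : ℝ) : Prop where
  ae_pos : ∀ᵐ t ∂(volume.restrict (Icc a b)), 0 < w t
  integrableOn : IntegrableOn w (Icc a b)
  integrableOn_log : IntegrableOn (fun t => Real.log (w t)) (Icc a b)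
  char_lt_top : ainfChar w a b < ∞

/-- `w ∈ A_∞^C(Q)` for `Q = [a, b]`. -/
def MemAinfC (C : ℝ) (w : ℝ → ℝ) (a b : ℝ) : Prop :=
  MemAinf w a b ∧ ainfChar w a b ≤ ENNReal.ofReal C

/-! On an interval J let φ have mean m, and put r = m - ξ, ψ = φ - r. The equation for ξ says C e^ξ
= 1/(1-ξ). So on any interval where φ has mean x + ξ, the A_∞ bound says precisely that `expGap ξ (φ
- x)` has nonpositive integral (`integral_expGap_nonpos`).

For each level x ≥ r, the rising sun lemma splits J, up to a null set, into intervals where φ has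
mean exactly x + ξ and a remainder where φ ≤ x + ξ. Hence the inequality survives replacing φ - x by
its positive part (`integral_expGap_max_nonpos`).

Integrating these inequalities over the levels against e^{δx}, and adding a multiple of the one for
ψ itself, produces a majorant of a positive multiple of e^{δψ} - 1 - δψ/(1-δξ), with e^{δψ}
truncated at height L (`gapConst_mul_le`). As ψ has mean ξ, letting L → ∞ bounds the mean of e^{δψ}
by 1 + δξ/(1-δξ) = 1/(1-δξ), and multiplying by e^{δ(r-m)} = e^{-δξ} gives the claim.

For sharpness, (t-a)^{-p} with p < 1 has characteristic e^{-p}/(1-p), attained on intervals starting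
at a. The choice p = ξ gives C, and the δ-th power has exponent δξ, which is not integrable once δξ
≥ 1. -/

/-! ### Calculus of the gap function and the pointwise majorant. -/

/-- The function `s ↦ e^s - 1 - s / (1 - ξ)`. -/
noncomputable def expGap (ξ s : ℝ) : ℝ := Real.exp s - 1 - s / (1 - ξ)

@[fun_prop]
theorem continuous_expGap (ξ : ℝ) : Continuous (expGap ξ) := by
  unfold expGap; fun_prop

theorem expGap_zero (ξ : ℝ) : expGap ξ 0 = 0 := by simp [expGap]

theorem one_le_one_div_one_sub {ξ : ℝ} (h0 : 0 ≤ ξ) (h1 : ξ < 1) : 1 ≤ 1 / (1 - ξ) := by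
  rw [le_div_iff₀ (by linarith)]; linarith

/-- The slope 1/(1-ξ) is at least 1, so for s ≤ 0 the subtracted line lies below the tangent 1 + s
of the exponential. Cutting off negative values therefore only lowers the gap. -/
theorem expGap_nonneg_of_nonpos {ξ s : ℝ} (h0 : 0 ≤ ξ) (h1 : ξ < 1) (hs : s ≤ 0) :
    0 ≤ expGap ξ s := by
  have h2 := one_le_one_div_one_sub h0 h1
  have h3 := Real.add_one_le_exp s
  have h4 : s / (1 - ξ) = s * (1 / (1 - ξ)) := by ring
  unfold expGap
  rw [h4]
  nlinarith

theorem expGap_nonpos {ξ s : ℝ} (h1 : ξ < 1) (hs : 0 ≤ s) (hs' : s ≤ ξ) :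
    expGap ξ s ≤ 0 := by
  have h2 : Real.exp s ≤ 1 / (1 - s) := by
    rw [le_div_iff₀ (by linarith)]
    have h3 := Real.add_one_le_exp (-s)
    have h4 : Real.exp s * Real.exp (-s) = 1 := by rw [← Real.exp_add]; simp
    nlinarith [Real.exp_pos s]
  have h3 : 1 / (1 - s) = 1 + s / (1 - s) := by
    have : (1 - s) ≠ 0 := by linarith
    field_simp; ring
  have h4 : s / (1 - s) ≤ s / (1 - ξ) := by
    apply div_le_div_of_nonneg_left hs <;> linarith
  unfold expGap
  linarith

/-- The function `R` for which `e^{δλ} R(s - λ)` is an antiderivative of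
`e^{δλ} (e^{s-λ} - 1 - (s - λ) / (1 - ξ))`. -/
noncomputable def expGapPrim (ξ δ s : ℝ) : ℝ :=
  Real.exp s / (δ - 1) - 1 / δ - s / (δ * (1 - ξ)) - 1 / (δ ^ 2 * (1 - ξ))

theorem hasDerivAt_expGapPrim {ξ δ : ℝ} (hδ : 1 < δ) (hξ : ξ < 1) (s x : ℝ) :
    HasDerivAt (fun x => Real.exp (δ * x) * expGapPrim ξ δ (s - x))
      (Real.exp (δ * x) * expGap ξ (s - x)) x := by
  have hsub : HasDerivAt (fun x => s - x) (-1) x := by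
    simpa using (hasDerivAt_id x).const_sub s
  have h1 : HasDerivAt (fun x => Real.exp (δ * x)) (Real.exp (δ * x) * δ) x := by
    simpa using ((hasDerivAt_id x).const_mul δ).exp
  have h2 : HasDerivAt (fun x => expGapPrim ξ δ (s - x))
      (Real.exp (s - x) * (-1) / (δ - 1) - (-1) / (δ * (1 - ξ))) x := by
    unfold expGapPrim
    exact (((hsub.exp.div_const _).sub_const _).sub (hsub.div_const _)).sub_const _
  refine (h1.mul h2).congr_deriv ?_
  have : δ - 1 ≠ 0 := by linarith
  have : δ ≠ 0 := by linarith
  have : 1 - ξ ≠ 0 := by linarith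
  unfold expGapPrim expGap
  field_simp
  ring

/-- The value of `expGapPrim ξ δ` at zero. -/
noncomputable def gapConst (ξ δ : ℝ) : ℝ := (1 - δ * ξ) / (δ ^ 2 * (δ - 1) * (1 - ξ))

theorem gapConst_pos {ξ δ : ℝ} (hδ : 1 < δ) (hξ : ξ < 1) (h : δ * ξ < 1) : 0 < gapConst ξ δ := by
  have : 0 < δ - 1 := by linarith
  have : 0 < δ := by linarith
  have : 0 < 1 - ξ := by linarith
  have : 0 < 1 - δ * ξ := by linarith
  unfold gapConst
  positivity

/-- The coefficient 1/(δ-1) is the one that cancels e^s, so that only an affine function of s is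
left. -/
theorem expGapPrim_sub {ξ δ : ℝ} (hδ : 1 < δ) (hξ : ξ < 1) (h : δ * ξ < 1) (s : ℝ) :
    expGapPrim ξ δ s - expGap ξ s / (δ - 1) = gapConst ξ δ * (1 + δ * s / (1 - δ * ξ)) := by
  have : δ - 1 ≠ 0 := by linarith
  have : δ ≠ 0 := by linarith
  have : 1 - ξ ≠ 0 := by linarith
  have : 1 - δ * ξ ≠ 0 := by linarith
  unfold expGapPrim expGap gapConst
  field_simp
  ring

/-- Needed for s > L, where the integral over levels stops at L before the positive part of s - x
has reached zero. -/
theorem gapConst_le_expGapPrim {ξ δ s : ℝ} (hδ : 1 < δ) (hξ : ξ < 1)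
    (h : δ * ξ < 1) (hs : 0 ≤ s) : gapConst ξ δ ≤ expGapPrim ξ δ s := by
  have h1 : 0 < δ - 1 := by linarith
  have h2 : 0 < δ := by linarith
  have h3 : 0 < 1 - ξ := by linarith
  have h4 : expGapPrim ξ δ s - gapConst ξ δ =
      (Real.exp s - 1 - s) / (δ - 1) + s * (1 - δ * ξ) / ((δ - 1) * δ * (1 - ξ)) := by
    unfold expGapPrim gapConst
    field_simp
    ring
  have h5 : 0 ≤ Real.exp s - 1 - s := by linarith [Real.add_one_le_exp s]
  have h6 : 0 < 1 - δ * ξ := by linarith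
  have h7 : 0 ≤ expGapPrim ξ δ s - gapConst ξ δ := by rw [h4]; positivity
  linarith

theorem expGapPrim_zero {ξ δ : ℝ} (hδ : 1 < δ) (hξ : ξ < 1) :
    expGapPrim ξ δ 0 = gapConst ξ δ := by
  have : δ - 1 ≠ 0 := by linarith
  have : δ ≠ 0 := by linarith
  have : 1 - ξ ≠ 0 := by linarith
  unfold expGapPrim gapConst
  simp only [Real.exp_zero, zero_div]
  field_simp
  ring

/-- With denominators cleared, the difference of the two sides is a function f that is convex on s ≤
0 with f(0) = f'(0) = 0. -/
theorem gapConst_mul_le_of_nonpos {ξ δ s : ℝ} (h0 : 0 ≤ ξ) (hδ : 1 < δ) (hξ : ξ < 1)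
    (h : δ * ξ < 1) (hs : s ≤ 0) :
    gapConst ξ δ * (Real.exp (δ * s) - 1 - δ * s / (1 - δ * ξ)) ≤ expGap ξ s / (δ - 1) := by
  set f : ℝ → ℝ := fun s => δ ^ 2 * (1 - ξ) * (Real.exp s - 1) - δ ^ 2 * s + δ * s
    - (1 - δ * ξ) * (Real.exp (δ * s) - 1) with hf
  set f' : ℝ → ℝ := fun s => δ ^ 2 * (1 - ξ) * Real.exp s - δ ^ 2 + δ
    - (1 - δ * ξ) * (Real.exp (δ * s) * δ) with hf'
  have hexp : ∀ x : ℝ, HasDerivAt (fun x => Real.exp (δ * x)) (Real.exp (δ * x) * δ) x := by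
    intro x
    simpa using ((hasDerivAt_id x).const_mul δ).exp
  have hd : ∀ x, HasDerivAt f (f' x) x := by
    intro x
    have := ((((Real.hasDerivAt_exp x).sub_const 1).const_mul (δ ^ 2 * (1 - ξ))).sub
      ((hasDerivAt_id x).const_mul (δ ^ 2))).add ((hasDerivAt_id x).const_mul δ)
    refine (this.sub (((hexp x).sub_const 1).const_mul (1 - δ * ξ))).congr_deriv ?_
    simp [hf']
  have hd' : ∀ x, HasDerivAt f' (δ ^ 2 * Real.exp x *
      ((1 - ξ) - (1 - δ * ξ) * Real.exp ((δ - 1) * x))) x := by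
    intro x
    have := (((Real.hasDerivAt_exp x).const_mul (δ ^ 2 * (1 - ξ))).sub_const (δ ^ 2)).add_const δ
    refine (this.sub (((hexp x).mul_const δ).const_mul (1 - δ * ξ))).congr_deriv ?_
    have : Real.exp (δ * x) = Real.exp x * Real.exp ((δ - 1) * x) := by
      rw [← Real.exp_add]; congr 1; ring
    rw [this]; ring
  have hmono : MonotoneOn f' (Iic 0) := by
    apply monotoneOn_of_deriv_nonneg (convex_Iic 0)
    · exact fun x _ => (hd' x).continuousAt.continuousWithinAt
    · exact fun x _ => (hd' x).differentiableAt.differentiableWithinAt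
    · intro x hx
      rw [interior_Iic] at hx
      rw [(hd' x).deriv]
      have h1 : Real.exp ((δ - 1) * x) ≤ 1 := by
        rw [Real.exp_le_one_iff]
        exact mul_nonpos_of_nonneg_of_nonpos (by linarith) (le_of_lt hx)
      -- Here 1 - δξ ≤ 1 - ξ because δ > 1 and ξ ≥ 0.
      have h2 : 0 ≤ (1 - ξ) - (1 - δ * ξ) * Real.exp ((δ - 1) * x) := by nlinarith
      positivity
  have hanti : AntitoneOn f (Iic 0) := by
    apply antitoneOn_of_deriv_nonpos (convex_Iic 0)
    · exact fun x _ => (hd x).continuousAt.continuousWithinAt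
    · exact fun x _ => (hd x).differentiableAt.differentiableWithinAt
    · intro x hx
      rw [interior_Iic] at hx
      rw [(hd x).deriv]
      have h1 := hmono (mem_Iic.2 (le_of_lt (mem_Iio.1 hx))) self_mem_Iic (le_of_lt (mem_Iio.1 hx))
      have h2 : f' 0 = 0 := by simp [hf']; ring
      linarith
  have h1 : 0 ≤ f s := by
    have h1 := hanti (hs : s ∈ Iic 0) self_mem_Iic hs
    have h2 : f 0 = 0 := by simp [hf]
    linarith
  have g1 : 0 < δ - 1 := by linarith
  have g2 : 0 < δ := by linarith
  have g3 : 0 < 1 - ξ := by linarith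
  have g4 : 0 < 1 - δ * ξ := by linarith
  have h2 : expGap ξ s / (δ - 1) - gapConst ξ δ * (Real.exp (δ * s) - 1 - δ * s / (1 - δ * ξ))
      = f s / (δ ^ 2 * (δ - 1) * (1 - ξ)) := by
    have g5 : gapConst ξ δ * (Real.exp (δ * s) - 1 - δ * s / (1 - δ * ξ)) =
        ((1 - δ * ξ) * (Real.exp (δ * s) - 1) - δ * s) / (δ ^ 2 * (δ - 1) * (1 - ξ)) := by
      rw [gapConst, div_mul_eq_mul_div, mul_sub, mul_div_cancel₀ _ g4.ne']
    rw [g5]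
    simp only [hf]
    unfold expGap
    field_simp
    ring
  have h3 : 0 ≤ f s / (δ ^ 2 * (δ - 1) * (1 - ξ)) := by positivity
  linarith

theorem integral_exp_mul_expGap {ξ δ : ℝ} (hδ : 1 < δ) (hξ : ξ < 1) (s r : ℝ) :
    ∫ x in (0 : ℝ)..r, Real.exp (δ * x) * expGap ξ (s - x)
      = Real.exp (δ * r) * expGapPrim ξ δ (s - r) - expGapPrim ξ δ s := by
  have h := intervalIntegral.integral_eq_sub_of_hasDerivAt (a := 0) (b := r)
    (fun x _ => hasDerivAt_expGapPrim (ξ := ξ) hδ hξ s x)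
    (Continuous.intervalIntegrable (by fun_prop) _ _)
  simpa using h

/-- For 0 ≤ s ≤ L this is an equality: the integrand vanishes for x ≥ s, the antiderivative
evaluates the rest, and `expGapPrim_sub` makes the remainder affine. Below 0 only the last term is
present; above L the truncation loses something of the right sign. -/
theorem gapConst_mul_le {ξ δ L : ℝ} (h0 : 0 ≤ ξ) (hδ : 1 < δ) (hξ : ξ < 1)
    (h : δ * ξ < 1) (hL : 0 ≤ L) (s : ℝ) :
    gapConst ξ δ * (Real.exp (δ * min s L) - 1 - δ * s / (1 - δ * ξ)) ≤
      (∫ x in (0 : ℝ)..L, Real.exp (δ * x) * expGap ξ (max (s - x) 0)) + expGap ξ s / (δ - 1) := by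
  have hzero : ∀ r, 0 ≤ r → s ≤ r → r ≤ L →
      ∫ x in r..L, Real.exp (δ * x) * expGap ξ (max (s - x) 0) = 0 := by
    intro r _ hsr hrL
    have : ∫ x in r..L, Real.exp (δ * x) * expGap ξ (max (s - x) 0) = ∫ x in r..L, (0 : ℝ) := by
      apply intervalIntegral.integral_congr
      intro x hx
      rw [uIcc_of_le hrL] at hx
      have : max (s - x) 0 = 0 := max_eq_right (by linarith [hx.1])
      simp [this, expGap_zero]
    simpa using this
  have hpos : ∀ r, 0 ≤ r → r ≤ s →
      ∫ x in (0 : ℝ)..r, Real.exp (δ * x) * expGap ξ (max (s - x) 0) =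
        Real.exp (δ * r) * expGapPrim ξ δ (s - r) - expGapPrim ξ δ s := by
    intro r hr hrs
    rw [← integral_exp_mul_expGap hδ hξ]
    apply intervalIntegral.integral_congr
    intro x hx
    rw [uIcc_of_le hr] at hx
    have : max (s - x) 0 = s - x := max_eq_left (by linarith [hx.2])
    simp [this]
  have hsub := expGapPrim_sub hδ hξ h s
  rcases le_total s 0 with hs | hs
  · rw [hzero 0 le_rfl hs hL, zero_add, min_eq_left (hs.trans hL)]
    exact gapConst_mul_le_of_nonpos h0 hδ hξ h hs
  rcases le_total s L with hsL | hsL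
  · rw [← intervalIntegral.integral_add_adjacent_intervals (b := s)
      (Continuous.intervalIntegrable (by fun_prop) _ _)
      (Continuous.intervalIntegrable (by fun_prop) _ _),
      hzero s hs le_rfl hsL, hpos s hs le_rfl, min_eq_left hsL, sub_self,
      expGapPrim_zero hδ hξ]
    nlinarith
  · rw [hpos L hL hsL, min_eq_right hsL]
    have := gapConst_le_expGapPrim hδ hξ h (sub_nonneg.2 hsL)
    nlinarith [mul_le_mul_of_nonneg_left this (Real.exp_pos (δ * L)).le]

theorem abs_expGap_max_le {ξ : ℝ} (hξ : ξ < 1) {s x : ℝ} (hx : 0 ≤ x) :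
    |expGap ξ (max (s - x) 0)| ≤ Real.exp s + 2 + |s| / (1 - ξ) := by
  have h1 : Real.exp (max (s - x) 0) ≤ Real.exp s + 1 := by
    rcases le_total (s - x) 0 with h | h
    · rw [max_eq_right h, Real.exp_zero]; linarith [Real.exp_pos s]
    · rw [max_eq_left h]
      linarith [Real.exp_le_exp.2 (by linarith : s - x ≤ s)]
  have h2 : max (s - x) 0 / (1 - ξ) ≤ |s| / (1 - ξ) := by
    apply div_le_div_of_nonneg_right _ (by linarith)
    exact max_le (by linarith [le_abs_self s]) (abs_nonneg s)
  have h3 : 0 ≤ max (s - x) 0 / (1 - ξ) := div_nonneg (le_max_right _ _) (by linarith)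
  have h4 : 1 ≤ Real.exp (max (s - x) 0) := Real.one_le_exp (le_max_right _ _)
  unfold expGap
  rw [abs_le]
  constructor <;> linarith [Real.exp_pos s]

/-! ### Integration over the levels on a finite measure space. -/

section Abstract

variable {α : Type*} [MeasurableSpace α] {μ : Measure α} [IsFiniteMeasure μ] {ψ : α → ℝ}

theorem integrable_exp_min {δ L : ℝ} (hδ : 0 < δ) (hψ : AEStronglyMeasurable ψ μ) :
    Integrable (fun t => Real.exp (δ * min (ψ t) L)) μ := by
  refine Integrable.of_bound (C := Real.exp (δ * L)) ?_ ?_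
  · exact (by fun_prop : Continuous fun s : ℝ => Real.exp (δ * min s L)).comp_aestronglyMeasurable hψ
  · refine Filter.Eventually.of_forall fun t => ?_
    rw [Real.norm_eq_abs, abs_of_pos (Real.exp_pos _), Real.exp_le_exp]
    exact mul_le_mul_of_nonneg_left (min_le_right _ _) hδ.le

/-- Integrability of e^{δψ} is not yet known; the truncation keeps every integral finite while the
bound stays independent of L. -/
theorem integral_exp_min_le {ξ δ L : ℝ} (h0 : 0 ≤ ξ) (hδ : 1 < δ) (hξ : ξ < 1)
    (h : δ * ξ < 1) (hL : 0 ≤ L) (hψ : Integrable ψ μ)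
    (hexp : Integrable (fun t => Real.exp (ψ t)) μ)
    (hgap : ∫ t, expGap ξ (ψ t) ∂μ ≤ 0)
    (hlev : ∀ x : ℝ, 0 ≤ x → ∫ t, expGap ξ (max (ψ t - x) 0) ∂μ ≤ 0) :
    ∫ t, Real.exp (δ * min (ψ t) L) ∂μ ≤ ∫ t, (1 + δ * ψ t / (1 - δ * ξ)) ∂μ := by
  have hgi : Integrable (fun t => expGap ξ (ψ t)) μ := by
    unfold expGap
    exact (hexp.sub (integrable_const 1)).sub (hψ.div_const _)
  have hlin : Integrable (fun t => 1 + δ * ψ t / (1 - δ * ξ)) μ :=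
    (integrable_const 1).add ((hψ.const_mul δ).div_const _)
  -- Fubini is justified by a majorant integrable in t and constant in the level, which ranges over
  -- a bounded interval.
  have hprod : Integrable (fun z : ℝ × α => Real.exp (δ * z.1) * expGap ξ (max (ψ z.2 - z.1) 0))
      ((volume.restrict (Ioc 0 L)).prod μ) := by
    have hb : Integrable (fun z : ℝ × α => Real.exp (δ * L) *
        (Real.exp (ψ z.2) + 2 + |ψ z.2| / (1 - ξ))) ((volume.restrict (Ioc 0 L)).prod μ) := by
      have := (integrable_const (μ := volume.restrict (Ioc 0 L)) (Real.exp (δ * L))).mul_prod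
        ((hexp.add (integrable_const 2)).add (hψ.abs.div_const (1 - ξ)))
      simpa using this
    refine hb.mono' ?_ ?_
    · have hc : Continuous fun z : ℝ × ℝ => Real.exp (δ * z.1) * expGap ξ (max (z.2 - z.1) 0) := by
        fun_prop
      exact hc.comp_aestronglyMeasurable
        (measurable_fst.aestronglyMeasurable.prodMk hψ.aestronglyMeasurable.comp_snd)
    · have : ∀ᵐ z ∂((volume.restrict (Ioc 0 L)).prod μ), z.1 ∈ Ioc 0 L :=
        Measure.quasiMeasurePreserving_fst.ae (ae_restrict_mem measurableSet_Ioc)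
      filter_upwards [this] with z hz
      rw [norm_mul, Real.norm_eq_abs, Real.norm_eq_abs, abs_of_pos (Real.exp_pos _)]
      apply mul_le_mul _ (abs_expGap_max_le hξ hz.1.le) (abs_nonneg _) (Real.exp_pos _).le
      rw [Real.exp_le_exp]
      exact mul_le_mul_of_nonneg_left hz.2 (by linarith)
  have hswap := integral_integral_swap (f := fun (x : ℝ) (t : α) =>
    Real.exp (δ * x) * expGap ξ (max (ψ t - x) 0)) hprod
  have hle : ∫ x in Ioc 0 L, ∫ t, Real.exp (δ * x) * expGap ξ (max (ψ t - x) 0) ∂μ ≤ 0 := by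
    apply setIntegral_nonpos measurableSet_Ioc
    intro x hx
    rw [integral_const_mul]
    exact mul_nonpos_of_nonneg_of_nonpos (Real.exp_pos _).le (hlev x hx.1.le)
  have hint : Integrable (fun t => ∫ x in Ioc 0 L, Real.exp (δ * x) *
      expGap ξ (max (ψ t - x) 0)) μ := hprod.integral_prod_right
  have hmain : ∫ t, gapConst ξ δ * (Real.exp (δ * min (ψ t) L) - (1 + δ * ψ t / (1 - δ * ξ))) ∂μ ≤
      ∫ t, ((∫ x in Ioc 0 L, Real.exp (δ * x) * expGap ξ (max (ψ t - x) 0)) +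
        expGap ξ (ψ t) / (δ - 1)) ∂μ := by
    apply integral_mono
    · exact ((integrable_exp_min (by linarith) hψ.aestronglyMeasurable).sub hlin).const_mul _
    · exact hint.add (hgi.div_const _)
    · intro t
      have := gapConst_mul_le h0 hδ hξ h hL (ψ t)
      rw [intervalIntegral.integral_of_le hL] at this
      simpa [sub_sub] using this
  rw [integral_add hint (hgi.div_const _), integral_div, integral_const_mul,
    integral_sub (integrable_exp_min (by linarith) hψ.aestronglyMeasurable) hlin] at hmain
  have h5 : (∫ t, expGap ξ (ψ t) ∂μ) / (δ - 1) ≤ 0 :=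
    div_nonpos_of_nonpos_of_nonneg hgap (by linarith)
  have h6 := gapConst_pos hδ hξ h
  have h7 : gapConst ξ δ * (∫ t, Real.exp (δ * min (ψ t) L) ∂μ -
      ∫ t, (1 + δ * ψ t / (1 - δ * ξ)) ∂μ) ≤ 0 := by linarith
  have := nonpos_of_mul_nonpos_right h7 h6
  linarith

/-- Monotone convergence in the truncation height gives integrability and the bound together. -/
theorem integrable_exp_mul_and_integral_le {ξ δ : ℝ} (h0 : 0 ≤ ξ) (hδ : 1 < δ) (hξ : ξ < 1)
    (h : δ * ξ < 1) (hψ : Integrable ψ μ)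
    (hexp : Integrable (fun t => Real.exp (ψ t)) μ)
    (hgap : ∫ t, expGap ξ (ψ t) ∂μ ≤ 0)
    (hlev : ∀ x : ℝ, 0 ≤ x → ∫ t, expGap ξ (max (ψ t - x) 0) ∂μ ≤ 0) :
    Integrable (fun t => Real.exp (δ * ψ t)) μ ∧
      ∫ t, Real.exp (δ * ψ t) ∂μ ≤ ∫ t, (1 + δ * ψ t / (1 - δ * ξ)) ∂μ := by
  set K := ∫ t, (1 + δ * ψ t / (1 - δ * ξ)) ∂μ
  have hδ0 : 0 < δ := by linarith
  have hm : AEStronglyMeasurable (fun t => Real.exp (δ * ψ t)) μ :=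
    (by fun_prop : Continuous fun s : ℝ => Real.exp (δ * s)).comp_aestronglyMeasurable
      hψ.aestronglyMeasurable
  have hK : ∀ n : ℕ, ∫ t, Real.exp (δ * min (ψ t) n) ∂μ ≤ K := fun n =>
    integral_exp_min_le h0 hδ hξ h n.cast_nonneg hψ hexp hgap hlev
  have hK0 : 0 ≤ K := (integral_nonneg fun t => (Real.exp_pos _).le).trans (hK 0)
  have hlint : ∫⁻ t, ENNReal.ofReal (Real.exp (δ * ψ t)) ∂μ ≤ ENNReal.ofReal K := by
    have htend : Filter.Tendsto (fun n : ℕ => ∫⁻ t, ENNReal.ofReal (Real.exp (δ * min (ψ t) n)) ∂μ)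
        Filter.atTop (nhds (∫⁻ t, ENNReal.ofReal (Real.exp (δ * ψ t)) ∂μ)) := by
      apply lintegral_tendsto_of_tendsto_of_monotone
      · intro n
        exact (integrable_exp_min hδ0 hψ.aestronglyMeasurable).aestronglyMeasurable.aemeasurable.ennreal_ofReal
      · refine Filter.Eventually.of_forall fun t m n hmn => ?_
        apply ENNReal.ofReal_le_ofReal
        rw [Real.exp_le_exp]
        apply mul_le_mul_of_nonneg_left _ hδ0.le
        exact min_le_min_left _ (by exact_mod_cast hmn)
      · refine Filter.Eventually.of_forall fun t => ?_
        apply tendsto_const_nhds.congr'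
        filter_upwards [Filter.eventually_ge_atTop ⌈ψ t⌉₊] with n hn
        rw [min_eq_left (Nat.ceil_le.1 hn)]
    refine le_of_tendsto' htend fun n => ?_
    rw [← ofReal_integral_eq_lintegral_ofReal (integrable_exp_min hδ0 hψ.aestronglyMeasurable)
      (Filter.Eventually.of_forall fun t => (Real.exp_pos _).le)]
    exact ENNReal.ofReal_le_ofReal (hK n)
  have hi : Integrable (fun t => Real.exp (δ * ψ t)) μ := by
    refine ⟨hm, ?_⟩
    rw [hasFiniteIntegral_iff_ofReal (Filter.Eventually.of_forall fun t => (Real.exp_pos _).le)]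
    exact hlint.trans_lt ENNReal.ofReal_lt_top
  refine ⟨hi, ?_⟩
  rw [← ofReal_integral_eq_lintegral_ofReal hi
    (Filter.Eventually.of_forall fun t => (Real.exp_pos _).le)] at hlint
  exact (ENNReal.ofReal_le_ofReal_iff hK0).1 hlint

end Abstract

/-! ### The rising sun lemma. -/

/-- The points `x` of `[p, b]` for which `F` takes a value above `F x` to the right of `x`. -/
def shadow (F : ℝ → ℝ) (p b : ℝ) : Set ℝ := {x | x ∈ Icc p b ∧ ∃ y ∈ Ioc x b, F x < F y}

theorem le_of_notMem_shadow {F : ℝ → ℝ} {p b x y : ℝ} (hx : x ∈ Icc p b)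
    (hxS : x ∉ shadow F p b) (hy : y ∈ Icc x b) : F y ≤ F x := by
  rcases eq_or_lt_of_le hy.1 with h | h
  · rw [h]
  · by_contra hlt
    exact hxS ⟨hx, y, ⟨h, hy.2⟩, not_le.1 hlt⟩

theorem isClosed_Icc_diff_shadow {F : ℝ → ℝ} {p b : ℝ} (hpb : p ≤ b)
    (hF : ContinuousOn F (Icc p b)) :
    IsClosed (Icc p b \ shadow F p b) := by
  -- For each y, a point outside the shadow either has F at least F y or lies at or beyond y; both
  -- conditions are closed. Taking y = b also forces x into [p, b].
  have : Icc p b \ shadow F p b = ⋂ y ∈ Icc p b, {x ∈ Icc p b | F y ≤ F x} ∪ Icc y b := by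
    ext x
    simp only [mem_iInter, mem_union, mem_ofPred_eq, mem_sdiff]
    constructor
    · rintro ⟨hx, hxS⟩ y hy
      rcases le_total x y with h | h
      · exact Or.inl ⟨hx, le_of_notMem_shadow hx hxS ⟨h, hy.2⟩⟩
      · exact Or.inr ⟨h, hx.2⟩
    · intro h
      have hxI : x ∈ Icc p b := by
        rcases h b (right_mem_Icc.2 hpb) with h | h
        · exact h.1
        · exact ⟨hpb.trans h.1, h.2⟩
      refine ⟨hxI, ?_⟩
      rintro ⟨-, y, hy, hlt⟩
      rcases h y ⟨hxI.1.trans hy.1.le, hy.2⟩ with h | h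
      · exact absurd h.2 (not_le.2 hlt)
      · exact absurd h.1 (not_le.2 hy.1)
  rw [this]
  refine isClosed_biInter fun y _ => IsClosed.union ?_ isClosed_Icc
  exact hF.preimage_isClosed_of_isClosed isClosed_Icc isClosed_Ici

/-- The rising sun lemma: if `F` is continuous on `[p, b]` with its maximum at `p`, then every
point of the shadow lies in an interval of the shadow whose endpoints are not in the shadow and at
which `F` takes the same value. -/
theorem exists_Ioo_subset_shadow {F : ℝ → ℝ} {p b : ℝ} (hF : ContinuousOn F (Icc p b))
    (hmax : ∀ y ∈ Icc p b, F y ≤ F p) {x : ℝ} (hx : x ∈ shadow F p b) :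
    ∃ c d, p ≤ c ∧ c < x ∧ x < d ∧ d ≤ b ∧ Ioo c d ⊆ shadow F p b ∧
      c ∉ shadow F p b ∧ d ∉ shadow F p b ∧ F c = F d := by
  set S := shadow F p b with hS
  have hpx := hx.1.1
  have hxb := hx.1.2
  have hcl := isClosed_Icc_diff_shadow (hpx.trans hxb) hF
  have hpS : p ∉ S := by
    rintro ⟨-, y, hy, hlt⟩
    exact absurd (hmax y ⟨hy.1.le, hy.2⟩) (not_le.2 hlt)
  have hbS : b ∉ S := by
    rintro ⟨-, y, hy, -⟩
    exact absurd hy.2 (not_le.2 hy.1)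
  obtain ⟨c, hc⟩ : ∃ c, IsGreatest ((Icc p b \ S) ∩ Iic x) c := by
    apply IsCompact.exists_isGreatest
    · exact (isCompact_Icc.of_isClosed_subset hcl sdiff_subset).inter_right isClosed_Iic
    · exact ⟨p, ⟨left_mem_Icc.2 (hpx.trans hxb), hpS⟩, hpx⟩
  obtain ⟨d, hd⟩ : ∃ d, IsLeast ((Icc p b \ S) ∩ Ici x) d := by
    apply IsCompact.exists_isLeast
    · exact (isCompact_Icc.of_isClosed_subset hcl sdiff_subset).inter_right isClosed_Ici
    · exact ⟨b, ⟨right_mem_Icc.2 (hpx.trans hxb), hbS⟩, hxb⟩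
  obtain ⟨⟨⟨hcI, hcS⟩, hcx⟩, hcmax⟩ := hc
  obtain ⟨⟨⟨hdI, hdS⟩, hxd⟩, hdmin⟩ := hd
  have hcx : c < x := lt_of_le_of_ne hcx (by rintro rfl; exact hcS hx)
  have hxd : x < d := lt_of_le_of_ne hxd (by rintro rfl; exact hdS hx)
  have hsub : Ioo c d ⊆ S := by
    intro z hz
    by_contra hzS
    have hzI : z ∈ Icc p b := ⟨hcI.1.trans hz.1.le, hz.2.le.trans hdI.2⟩
    rcases le_total z x with h | h
    · exact absurd (hcmax ⟨⟨hzI, hzS⟩, h⟩) (not_le.2 hz.1)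
    · exact absurd (hdmin ⟨⟨hzI, hzS⟩, h⟩) (not_le.2 hz.2)
  -- A maximum point y of F on [z, d] with y < d would be in the shadow, hence beaten by some w.
  -- Then w > d, but F w ≤ F d ≤ F y since d is outside the shadow.
  have hle : ∀ z ∈ Ioo c d, F z ≤ F d := by
    intro z hz
    obtain ⟨y, hy, hymax⟩ := isCompact_Icc.exists_isMaxOn (nonempty_Icc.2 hz.2.le)
      (hF.mono (Icc_subset_Icc (hcI.1.trans hz.1.le) hdI.2))
    rcases eq_or_lt_of_le hy.2 with h | h
    · subst h; exact hymax (left_mem_Icc.2 hz.2.le)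
    · exfalso
      obtain ⟨-, w, hw, hlt⟩ := hsub ⟨hz.1.trans_le hy.1, h⟩
      rcases le_or_gt w d with hwd | hwd
      · exact absurd (hymax (⟨hy.1.trans hw.1.le, hwd⟩ : w ∈ Icc z d)) (not_le.2 hlt)
      · have h1 := le_of_notMem_shadow hdI hdS ⟨hwd.le, hw.2⟩
        have h2 : F d ≤ F y := hymax (right_mem_Icc.2 hz.2.le)
        linarith
  have hcd : c < d := hcx.trans hxd
  refine ⟨c, d, hcI.1, hcx, hxd, hdI.2, hsub, hcS, hdS, le_antisymm ?_ ?_⟩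
  · have hcont : ContinuousWithinAt F (Ioo c d) c :=
      (hF c hcI).mono (Ioo_subset_Icc_self.trans (Icc_subset_Icc hcI.1 hdI.2))
    have : (nhdsWithin c (Ioo c d)).NeBot := by
      rw [nhdsWithin_Ioo_eq_nhdsGT hcd]; infer_instance
    exact le_of_tendsto hcont (eventually_mem_nhdsWithin.mono hle)
  · exact le_of_notMem_shadow hcI hcS ⟨hcd.le, hdI.2⟩

theorem Ioo_disjoint_of_endpoints_notMem {S : Set ℝ} {c d c' d' : ℝ}
    (h : Ioo c d ⊆ S) (h' : Ioo c' d' ⊆ S) (hc : c ∉ S) (hd : d ∉ S) (hc' : c' ∉ S)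
    (hd' : d' ∉ S) (hne : (c, d) ≠ (c', d')) : Disjoint (Ioo c d) (Ioo c' d') := by
  rw [Set.disjoint_left]
  intro x hx hx'
  apply hne
  have e1 : c = c' := by
    rcases lt_trichotomy c c' with h1 | h1 | h1
    · exact absurd (h ⟨h1, hx'.1.trans hx.2⟩) hc'
    · exact h1
    · exact absurd (h' ⟨h1, hx.1.trans hx'.2⟩) hc
  have e2 : d = d' := by
    rcases lt_trichotomy d d' with h1 | h1 | h1
    · exact absurd (h' ⟨hx'.1.trans hx.2, h1⟩) hd
    · exact h1
    · exact absurd (h ⟨hx.1.trans hx'.2, h1⟩) hd'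
  rw [e1, e2]

/-- Off countably many disjoint intervals on which the mean of `f` is `0`, the function `f` is
nonpositive, provided that the mean of `f` on `[a, b]` is nonpositive. -/
theorem exists_intervals_integral_eq_zero {f : ℝ → ℝ} {a b : ℝ} (hab : a < b)
    (hf : IntervalIntegrable f volume a b) (hmean : ∫ x in a..b, f x ≤ 0) :
    ∃ T : Set (ℝ × ℝ), T.Countable ∧
      (∀ z ∈ T, a ≤ z.1 ∧ z.1 < z.2 ∧ z.2 ≤ b ∧ ∫ x in z.1..z.2, f x = 0) ∧
      T.PairwiseDisjoint (fun z => Ioo z.1 z.2) ∧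
      ∀ᵐ x, x ∈ Ioo a b → x ∉ ⋃ z ∈ T, Ioo z.1 z.2 → f x ≤ 0 := by
  set F : ℝ → ℝ := fun x => ∫ t in a..x, f t with hFdef
  have hF : ContinuousOn F (Icc a b) := by
    have := intervalIntegral.continuousOn_primitive_interval (μ := volume) (f := f) (a := a) (b := b)
      ((intervalIntegrable_iff' (by finiteness)).1 hf)
    rwa [uIcc_of_le hab.le] at this
  have hsubint : ∀ c d, a ≤ c → c ≤ d → d ≤ b → ∫ x in c..d, f x = F d - F c := by
    intro c d hc hcd hd
    have h1 : IntervalIntegrable f volume a c := hf.mono_set (by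
      rw [uIcc_of_le hc, uIcc_of_le hab.le]; exact Icc_subset_Icc le_rfl (hcd.trans hd))
    have h2 : IntervalIntegrable f volume a d := hf.mono_set (by
      rw [uIcc_of_le (hc.trans hcd), uIcc_of_le hab.le]; exact Icc_subset_Icc le_rfl hd)
    exact (intervalIntegral.integral_interval_sub_left h2 h1).symm
  have hFa : F a = 0 := by simp [hFdef]
  -- The last point p with F ≥ 0. Since F b ≤ 0, continuity forces F p = 0, so [a, p] is itself an
  -- interval of mean zero, and F attains its maximum over [p, b] at p.
  obtain ⟨p, ⟨hpI, hp0⟩, hplast⟩ : ∃ p, IsGreatest {x ∈ Icc a b | 0 ≤ F x} p := by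
    apply IsCompact.exists_isGreatest
    · exact isCompact_Icc.of_isClosed_subset
        (hF.preimage_isClosed_of_isClosed isClosed_Icc isClosed_Ici) (sep_subset _ _)
    · exact ⟨a, left_mem_Icc.2 hab.le, hFa.ge⟩
  have hFp : F p = 0 := by
    by_contra hne
    have hlt : 0 < F p := lt_of_le_of_ne hp0 (Ne.symm hne)
    obtain ⟨q, hq, hq0⟩ := intermediate_value_Icc' hpI.2 (hF.mono (Icc_subset_Icc hpI.1 le_rfl))
      (show (0 : ℝ) ∈ Icc (F b) (F p) from ⟨hmean, hp0⟩)
    have h1 : q ≤ p := hplast ⟨⟨hpI.1.trans hq.1, hq.2⟩, hq0.ge⟩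
    have h2 : q = p := le_antisymm h1 hq.1
    rw [h2] at hq0
    exact hne hq0
  have hmax : ∀ y ∈ Icc p b, F y ≤ F p := by
    intro y hy
    by_contra hlt
    rw [not_le, hFp] at hlt
    have h1 : y ≤ p := hplast ⟨⟨hpI.1.trans hy.1, hy.2⟩, hlt.le⟩
    rw [le_antisymm h1 hy.1, hFp] at hlt
    exact lt_irrefl _ hlt
  have hFpb : ContinuousOn F (Icc p b) := hF.mono (Icc_subset_Icc hpI.1 le_rfl)
  set S := shadow F p b with hS
  set T₀ : Set (ℝ × ℝ) := {z | p ≤ z.1 ∧ z.1 < z.2 ∧ z.2 ≤ b ∧ Ioo z.1 z.2 ⊆ S ∧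
    z.1 ∉ S ∧ z.2 ∉ S ∧ F z.1 = F z.2} with hT₀
  have hdisj₀ : T₀.PairwiseDisjoint (fun z => Ioo z.1 z.2) := by
    intro z hz w hw hne
    exact Ioo_disjoint_of_endpoints_notMem hz.2.2.2.1 hw.2.2.2.1 hz.2.2.2.2.1 hz.2.2.2.2.2.1
      hw.2.2.2.2.1 hw.2.2.2.2.2.1 hne
  set T : Set (ℝ × ℝ) := T₀ ∪ {z | z = (a, p) ∧ a < p} with hT
  have hprop : ∀ z ∈ T, a ≤ z.1 ∧ z.1 < z.2 ∧ z.2 ≤ b ∧ ∫ x in z.1..z.2, f x = 0 := by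
    rintro z (hz | ⟨rfl, hap⟩)
    · obtain ⟨h1, h2, h3, -, -, -, h4⟩ := hz
      refine ⟨hpI.1.trans h1, h2, h3, ?_⟩
      rw [hsubint _ _ (hpI.1.trans h1) h2.le h3, h4, sub_self]
    · exact ⟨le_rfl, hap, hpI.2, hFp⟩
  have hdisj : T.PairwiseDisjoint (fun z => Ioo z.1 z.2) := by
    have key : ∀ z ∈ T₀, Disjoint (Ioo z.1 z.2) (Ioo a p) := by
      intro z hz
      rw [Set.disjoint_left]
      intro x hx hx'
      exact absurd (hz.1.trans hx.1.le) (not_le.2 hx'.2)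
    rintro z (hz | ⟨rfl, -⟩) w (hw | ⟨rfl, -⟩) hne
    · exact hdisj₀ hz hw hne
    · exact key z hz
    · exact (key w hw).symm
    · exact absurd rfl hne
  refine ⟨T, ?_, hprop, hdisj, ?_⟩
  · exact hdisj.countable_of_isOpen (fun z _ => isOpen_Ioo)
      (fun z hz => nonempty_Ioo.2 (hprop z hz).2.1)
  · filter_upwards [hf.ae_hasDerivAt_integral, compl_mem_ae_iff.2 (measure_singleton p)]
      with x hx hxp hxab hxT
    have hxp : x ≠ p := hxp
    have hpx : p < x := by
      by_contra hle
      have hlt : x < p := lt_of_le_of_ne (not_lt.1 hle) hxp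
      exact hxT (mem_biUnion (Or.inr ⟨rfl, hxab.1.trans hlt⟩ : (a, p) ∈ T) ⟨hxab.1, hlt⟩)
    have hxS : x ∉ S := by
      intro hxS
      obtain ⟨c, d, h1, h2, h3, h4, h5, h6, h7, h8⟩ := exists_Ioo_subset_shadow hFpb hmax hxS
      exact hxT (mem_biUnion (Or.inl ⟨h1, h2.trans h3, h4, h5, h6, h7, h8⟩ : (c, d) ∈ T) ⟨h2, h3⟩)
    have hder : HasDerivAt F (f x) x :=
      hx (by rw [uIcc_of_le hab.le]; exact Ioo_subset_Icc_self hxab) a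
        (by rw [uIcc_of_le hab.le]; exact left_mem_Icc.2 hab.le)
    -- At a point outside the shadow every slope to the right is nonpositive, and almost everywhere
    -- these slopes tend to f x.
    have hslope := (hasDerivAt_iff_tendsto_slope.1 hder).mono_left
      (nhdsWithin_mono x (show Ioi x ⊆ {x}ᶜ from fun y hy => (mem_Ioi.1 hy).ne'))
    refine le_of_tendsto hslope ?_
    filter_upwards [Ioo_mem_nhdsGT hxab.2] with y hy
    have := le_of_notMem_shadow (F := F) (p := p) (b := b) ⟨hpx.le, hxab.2.le⟩ hxS
      (⟨hy.1.le, hy.2.le⟩ : y ∈ Icc x b)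
    rw [slope_def_field]
    exact div_nonpos_of_nonpos_of_nonneg (by linarith) (by linarith [hy.1])

/-! ### From the A_∞ bound to the level inequalities and self-improvement. -/

section Level

variable {φ : ℝ → ℝ} {a b C ξ : ℝ}

theorem intervalIntegrable_expGap (hφ : IntervalIntegrable φ volume a b)
    (hexp : IntervalIntegrable (fun t => Real.exp (φ t)) volume a b) (x : ℝ) :
    IntervalIntegrable (fun t => expGap ξ (φ t - x)) volume a b := by
  have h : (fun t => expGap ξ (φ t - x)) =
      fun t => Real.exp (-x) * Real.exp (φ t) - 1 - (φ t - x) / (1 - ξ) := by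
    funext t
    rw [expGap, ← Real.exp_add]
    congr 3
    ring
  rw [h]
  exact ((hexp.const_mul _).sub intervalIntegrable_const).sub
    ((hφ.sub intervalIntegrable_const).div_const _)

/-- If the mean of `φ` on an interval is `x + ξ` and the `A_∞` bound with constant `C` holds on it,
then the mean of `expGap ξ (φ - x)` is nonpositive. -/
theorem integral_expGap_nonpos (h1 : ξ < 1) (hC : Real.exp (-ξ) = C * (1 - ξ)) (hab : a < b)
    (hφ : IntervalIntegrable φ volume a b)
    (hexp : IntervalIntegrable (fun t => Real.exp (φ t)) volume a b)
    (hJ : (∫ t in a..b, Real.exp (φ t)) * Real.exp (-((∫ t in a..b, φ t) / (b - a))) ≤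
      C * (b - a)) {x : ℝ} (hx : ∫ t in a..b, φ t = (x + ξ) * (b - a)) :
    ∫ t in a..b, expGap ξ (φ t - x) ≤ 0 := by
  have h : (fun t => expGap ξ (φ t - x)) =
      fun t => Real.exp (-x) * Real.exp (φ t) - 1 - (φ t - x) / (1 - ξ) := by
    funext t
    rw [expGap, ← Real.exp_add]
    congr 3
    ring
  have hba : 0 < b - a := by linarith
  rw [h, intervalIntegral.integral_sub ((hexp.const_mul _).sub intervalIntegrable_const)
      ((hφ.sub intervalIntegrable_const).div_const _),
    intervalIntegral.integral_sub (hexp.const_mul _) intervalIntegrable_const,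
    intervalIntegral.integral_div,
    intervalIntegral.integral_sub hφ intervalIntegrable_const,
    intervalIntegral.integral_const_mul, hx]
  simp only [intervalIntegral.integral_const, smul_eq_mul]
  rw [hx, mul_div_cancel_right₀ _ hba.ne', neg_add, Real.exp_add, hC] at hJ
  have h1' : 0 < 1 - ξ := by linarith
  have hCpos : 0 < C := by
    have := Real.exp_pos (-ξ)
    rw [hC] at this
    exact pos_of_mul_pos_left this h1'.le
  have h2 : Real.exp (-x) * (∫ t in a..b, Real.exp (φ t)) ≤ (b - a) / (1 - ξ) := by
    rw [le_div_iff₀ h1']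
    have : C * (Real.exp (-x) * (∫ t in a..b, Real.exp (φ t)) * (1 - ξ)) ≤ C * (b - a) := by
      linarith
    exact le_of_mul_le_mul_left this hCpos
  have h3 : (b - a) / (1 - ξ) - (b - a) * 1 - ((x + ξ) * (b - a) - (b - a) * x) / (1 - ξ) = 0 := by
    field_simp
    ring
  linarith

/-- On each rising sun interval the mean of φ is x + ξ, so the uncut gap has nonpositive integral
and dominates the cut one. Elsewhere the positive part of φ - x lies in [0, ξ], where `expGap` is
nonpositive. -/
theorem integral_expGap_max_nonpos (h0 : 0 ≤ ξ) (h1 : ξ < 1) (hC : Real.exp (-ξ) = C * (1 - ξ))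
    (hab : a < b) (hφ : IntervalIntegrable φ volume a b)
    (hexp : IntervalIntegrable (fun t => Real.exp (φ t)) volume a b)
    (hJ : ∀ c d, a ≤ c → c < d → d ≤ b →
      (∫ t in c..d, Real.exp (φ t)) * Real.exp (-((∫ t in c..d, φ t) / (d - c))) ≤ C * (d - c))
    {x : ℝ} (hx : ∫ t in a..b, φ t ≤ (x + ξ) * (b - a)) :
    ∫ t in a..b, expGap ξ (max (φ t - x) 0) ≤ 0 := by
  obtain ⟨T, hTc, hT, hTd, hTae⟩ := exists_intervals_integral_eq_zero hab
    (hφ.sub (intervalIntegrable_const (c := x + ξ)))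
    (by rw [intervalIntegral.integral_sub hφ intervalIntegrable_const]
        simp only [intervalIntegral.integral_const, smul_eq_mul]; linarith)
  have hg := intervalIntegrable_expGap (ξ := ξ) hφ hexp x
  have hgI : IntegrableOn (fun t => expGap ξ (φ t - x)) (Ioc a b) :=
    (intervalIntegrable_iff_integrableOn_Ioc_of_le hab.le).1 hg
  set E := ⋃ z ∈ T, Ioo z.1 z.2 with hE
  have hEm : MeasurableSet E := MeasurableSet.biUnion hTc fun z _ => measurableSet_Ioo
  have hEsub : E ⊆ Ioc a b := by
    refine iUnion₂_subset fun z hz => ?_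
    obtain ⟨h1, -, h3, -⟩ := hT z hz
    exact fun y hy => ⟨h1.trans_lt hy.1, hy.2.le.trans h3⟩
  have hEint : ∫ t in E, expGap ξ (φ t - x) ≤ 0 := by
    have : Countable T := hTc.to_subtype
    rw [hE, biUnion_eq_iUnion, integral_iUnion (fun z : T => measurableSet_Ioo)
      (fun (z w : T) hne => hTd z.2 w.2 (Subtype.coe_injective.ne hne))
      (by rw [← biUnion_eq_iUnion T (fun z _ => Ioo z.1 z.2)]; exact hgI.mono_set hEsub)]
    refine tsum_nonpos fun z => ?_
    obtain ⟨h2, h3, h4, h5⟩ := hT z z.2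
    have hss : uIcc z.1.1 z.1.2 ⊆ uIcc a b := by
      rw [uIcc_of_le h3.le, uIcc_of_le hab.le]; exact Icc_subset_Icc h2 h4
    rw [← integral_Ioc_eq_integral_Ioo, ← intervalIntegral.integral_of_le h3.le]
    refine integral_expGap_nonpos h1 hC h3 (hφ.mono_set hss) (hexp.mono_set hss)
      (hJ _ _ h2 h3 h4) ?_
    rw [intervalIntegral.integral_sub (hφ.mono_set hss) intervalIntegrable_const] at h5
    simp only [intervalIntegral.integral_const, smul_eq_mul] at h5
    linarith
  have hind : ∫ t in Ioc a b, E.indicator (fun t => expGap ξ (φ t - x)) t =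
      ∫ t in E, expGap ξ (φ t - x) := by
    rw [setIntegral_indicator hEm, inter_eq_self_of_subset_right hEsub]
  have hIi : IntegrableOn (E.indicator fun t => expGap ξ (φ t - x)) (Ioc a b) :=
    hgI.indicator hEm
  refine le_trans ?_ (hind.trans_le hEint)
  rw [intervalIntegral.integral_of_le hab.le]
  have hmaxI : IntegrableOn (fun t => expGap ξ (max (φ t - x) 0)) (Ioc a b) := by
    have hφI := (intervalIntegrable_iff_integrableOn_Ioc_of_le hab.le).1 hφ
    refine hgI.norm.mono' ?_ ?_
    · exact (by fun_prop : Continuous fun s => expGap ξ (max (s - x) 0)).comp_aestronglyMeasurable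
        hφI.aestronglyMeasurable
    · refine Filter.Eventually.of_forall fun t => ?_
      rcases le_total (φ t - x) 0 with h | h
      · simp [max_eq_right h, expGap_zero]
      · rw [max_eq_left h]
  apply integral_mono_ae hmaxI hIi
  have hb : ∀ᵐ t : ℝ, t ≠ b := compl_mem_ae_iff.2 (measure_singleton b)
  filter_upwards [ae_restrict_of_ae hTae, ae_restrict_mem measurableSet_Ioc, ae_restrict_of_ae hb]
    with t ht htI htb
  by_cases htE : t ∈ E
  · rw [indicator_of_mem htE]
    rcases le_total (φ t - x) 0 with h | h
    · rw [max_eq_right h, expGap_zero]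
      exact expGap_nonneg_of_nonpos h0 h1 h
    · rw [max_eq_left h]
  · rw [indicator_of_notMem htE]
    have := ht ⟨htI.1, lt_of_le_of_ne htI.2 htb⟩ htE
    apply expGap_nonpos h1 (le_max_right _ _)
    exact max_le (by linarith) h0

/-- Self-improvement on one interval. -/
theorem integrable_exp_mul_and_integral_mul_le {δ : ℝ} (hδ : 1 < δ) (h : δ * ξ < 1) (h0 : 0 ≤ ξ)
    (h1 : ξ < 1) (hC : Real.exp (-ξ) = C * (1 - ξ))
    (hab : a < b) (hφ : IntervalIntegrable φ volume a b)
    (hexp : IntervalIntegrable (fun t => Real.exp (φ t)) volume a b)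
    (hJ : ∀ c d, a ≤ c → c < d → d ≤ b →
      (∫ t in c..d, Real.exp (φ t)) * Real.exp (-((∫ t in c..d, φ t) / (d - c))) ≤ C * (d - c)) :
    IntervalIntegrable (fun t => Real.exp (δ * φ t)) volume a b ∧
    (∫ t in a..b, Real.exp (δ * φ t)) * Real.exp (-((∫ t in a..b, δ * φ t) / (b - a))) ≤
      Real.exp (-(δ * ξ)) / (1 - δ * ξ) * (b - a) := by
  have hba : 0 < b - a := by linarith
  set m := (∫ t in a..b, φ t) / (b - a) with hm
  have hmI : ∫ t in a..b, φ t = m * (b - a) := by rw [hm]; field_simp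
  -- With this shift the mean of φ equals r + ξ, so level r is the lowest one to which the level
  -- inequality applies.
  set r := m - ξ with hr
  have hφr : IntervalIntegrable (fun t => φ t - r) volume a b := hφ.sub intervalIntegrable_const
  have hexpr : IntervalIntegrable (fun t => Real.exp (φ t - r)) volume a b := by
    simp only [Real.exp_sub]
    exact hexp.div_const _
  have h2 : ∫ t in a..b, expGap ξ (φ t - r) ≤ 0 :=
    integral_expGap_nonpos h1 hC hab hφ hexp (hJ a b le_rfl hab le_rfl) (by rw [hmI, hr]; ring)
  have h3 : ∀ x : ℝ, 0 ≤ x → ∫ t in a..b, expGap ξ (max (φ t - r - x) 0) ≤ 0 := by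
    intro x hx
    simp only [sub_sub]
    apply integral_expGap_max_nonpos h0 h1 hC hab hφ hexp hJ
    rw [hmI]
    exact mul_le_mul_of_nonneg_right (by linarith) hba.le
  rw [intervalIntegrable_iff_integrableOn_Ioc_of_le hab.le] at hφr hexpr
  simp only [intervalIntegral.integral_of_le hab.le] at h2 h3
  obtain ⟨hi, hle⟩ := integrable_exp_mul_and_integral_le h0 hδ h1 h hφr hexpr h2 h3
  have hfac : ∀ t, Real.exp (δ * φ t) = Real.exp (δ * r) * Real.exp (δ * (φ t - r)) := by
    intro t
    rw [← Real.exp_add]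
    congr 1
    ring
  rw [← intervalIntegral.integral_of_le hab.le, ← intervalIntegral.integral_of_le hab.le] at hle
  constructor
  · rw [intervalIntegrable_iff_integrableOn_Ioc_of_le hab.le]
    simp only [hfac]
    exact hi.const_mul _
  · have hφr' : IntervalIntegrable (fun t => φ t - r) volume a b :=
      hφ.sub intervalIntegrable_const
    have hv : ∫ t in a..b, (1 + δ * (φ t - r) / (1 - δ * ξ)) = (b - a) / (1 - δ * ξ) := by
      rw [intervalIntegral.integral_add intervalIntegrable_const
          ((hφr'.const_mul δ).div_const _), intervalIntegral.integral_div,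
        intervalIntegral.integral_const_mul,
        intervalIntegral.integral_sub hφ intervalIntegrable_const, hmI]
      simp only [intervalIntegral.integral_const, smul_eq_mul]
      have : 1 - δ * ξ ≠ 0 := by linarith
      rw [hr]
      field_simp
      ring
    rw [hv] at hle
    simp only [hfac]
    rw [intervalIntegral.integral_const_mul, intervalIntegral.integral_const_mul, hmI,
      ← mul_assoc δ, mul_div_cancel_right₀ _ hba.ne']
    have e : Real.exp (δ * r) * Real.exp (-(δ * m)) = Real.exp (-(δ * ξ)) := by
      rw [← Real.exp_add, hr]; congr 1; ring
    calc Real.exp (δ * r) * (∫ t in a..b, Real.exp (δ * (φ t - r))) * Real.exp (-(δ * m))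
        = Real.exp (-(δ * ξ)) * ∫ t in a..b, Real.exp (δ * (φ t - r)) := by rw [← e]; ring
      _ ≤ Real.exp (-(δ * ξ)) * ((b - a) / (1 - δ * ξ)) :=
        mul_le_mul_of_nonneg_left hle (Real.exp_pos _).le
      _ = _ := by ring

end Level

/-! ### Power weights on the half-line. -/

section PowerWeight

theorem exp_neg_mul_log_eq_rpow (p : ℝ) {u : ℝ} (hu : 0 < u) :
    Real.exp (-(p * Real.log u)) = u ^ (-p) := by
  rw [Real.rpow_def_of_pos hu]; congr 1; ring

theorem intervalIntegrable_exp_neg_mul_log {p c d : ℝ} (hp : p < 1) (hc : 0 ≤ c) (hcd : c < d) :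
    IntervalIntegrable (fun u => Real.exp (-(p * Real.log u))) volume c d := by
  refine (intervalIntegral.intervalIntegrable_rpow' (r := -p) (by linarith)).congr ?_
  intro u hu
  rw [uIoc_of_le hcd.le] at hu
  exact (exp_neg_mul_log_eq_rpow p (hc.trans_lt hu.1)).symm

theorem integral_exp_neg_mul_log {p c d : ℝ} (hp : p < 1) (hc : 0 ≤ c) (hcd : c < d) :
    ∫ u in c..d, Real.exp (-(p * Real.log u)) =
      (d * Real.exp (-(p * Real.log d)) - c * Real.exp (-(p * Real.log c))) / (1 - p) := by
  have h1 : ∫ u in c..d, Real.exp (-(p * Real.log u)) = ∫ u in c..d, u ^ (-p) := by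
    apply intervalIntegral.integral_congr_ae
    refine Filter.Eventually.of_forall fun u hu => ?_
    rw [uIoc_of_le hcd.le] at hu
    exact exp_neg_mul_log_eq_rpow p (hc.trans_lt hu.1)
  have h2 : ∀ v : ℝ, 0 ≤ v → v ^ (-p + 1) = v * Real.exp (-(p * Real.log v)) := by
    intro v hv
    rcases eq_or_lt_of_le hv with h | h
    -- The convention log 0 = 0 is harmless here because of the factor v, and 0 ^ (1 - p) = 0
    -- because p < 1.
    · rw [← h, zero_mul, Real.zero_rpow (by linarith)]
    · rw [Real.rpow_add h, Real.rpow_one, exp_neg_mul_log_eq_rpow p h, mul_comm]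
  rw [h1, integral_rpow (Or.inl (by linarith)), h2 d (hc.trans hcd.le), h2 c hc]
  congr 1
  ring

theorem integral_neg_mul_log (p c d : ℝ) :
    ∫ u in c..d, -(p * Real.log u) = -p * (d * Real.log d - c * Real.log c - (d - c)) := by
  rw [intervalIntegral.integral_neg, intervalIntegral.integral_const_mul, integral_log]
  ring

theorem integral_exp_mul_exp_neg_eq {p d : ℝ} (hp : p < 1) (hd : 0 < d) :
    (∫ u in (0 : ℝ)..d, Real.exp (-(p * Real.log u))) *
      Real.exp (-((∫ u in (0 : ℝ)..d, -(p * Real.log u)) / (d - 0))) =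
      Real.exp (-p) / (1 - p) * (d - 0) := by
  rw [integral_exp_neg_mul_log hp le_rfl hd, integral_neg_mul_log]
  have e : -(-p * (d * Real.log d - 0 * Real.log 0 - (d - 0)) / (d - 0)) =
      p * Real.log d + -p := by
    rw [sub_zero, zero_mul, sub_zero]
    field_simp
    ring
  rw [e, Real.exp_add]
  have e2 : Real.exp (-(p * Real.log d)) * Real.exp (p * Real.log d) = 1 := by
    rw [← Real.exp_add]; simp
  calc (d * Real.exp (-(p * Real.log d)) - 0 * Real.exp (-(p * Real.log 0))) / (1 - p) *
        (Real.exp (p * Real.log d) * Real.exp (-p))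
      = (Real.exp (-(p * Real.log d)) * Real.exp (p * Real.log d)) *
        (Real.exp (-p) / (1 - p) * (d - 0)) := by ring
    _ = _ := by rw [e2, one_mul]

/-- Since log d is the average of log c and θ with weights c/d and (d-c)/d, Jensen's inequality for
the exponential bounds the integral of u^{-p}. For c = 0 the first weight vanishes and nothing is
lost. -/
theorem integral_exp_mul_exp_neg_le {p c d : ℝ} (hp : p < 1) (hc : 0 ≤ c) (hcd : c < d) :
    (∫ u in c..d, Real.exp (-(p * Real.log u))) *
      Real.exp (-((∫ u in c..d, -(p * Real.log u)) / (d - c))) ≤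
      Real.exp (-p) / (1 - p) * (d - c) := by
  rw [integral_exp_neg_mul_log hp hc hcd, integral_neg_mul_log]
  have hdc : 0 < d - c := by linarith
  have hd : 0 < d := by linarith
  have hp' : 0 < 1 - p := by linarith
  set θ := (d * Real.log d - c * Real.log c) / (d - c) with hθ
  have hθ' : d * Real.log d - c * Real.log c = θ * (d - c) := by rw [hθ]; field_simp
  have e : -(-p * (d * Real.log d - c * Real.log c - (d - c)) / (d - c)) = p * θ + -p := by
    rw [hθ']
    field_simp
    ring
  have hconv : d * Real.exp (-(p * Real.log d)) ≤
      c * Real.exp (-(p * Real.log c)) + (d - c) * Real.exp (-(p * θ)) := by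
    have h := convexOn_exp.2 (mem_univ (-(p * Real.log c))) (mem_univ (-(p * θ)))
      (div_nonneg hc hd.le) (div_nonneg hdc.le hd.le) (by field_simp; ring)
    simp only [smul_eq_mul] at h
    have e3 : c / d * -(p * Real.log c) + (d - c) / d * -(p * θ) = -(p * Real.log d) := by
      have : d * Real.log d = θ * (d - c) + c * Real.log c := by linarith
      field_simp
      linear_combination p * this
    rw [e3] at h
    calc d * Real.exp (-(p * Real.log d)) ≤ d * (c / d * Real.exp (-(p * Real.log c)) +
          (d - c) / d * Real.exp (-(p * θ))) := mul_le_mul_of_nonneg_left h hd.le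
      _ = _ := by field_simp
  rw [e, Real.exp_add]
  have e2 : Real.exp (-(p * θ)) * Real.exp (p * θ) = 1 := by
    rw [← Real.exp_add]; simp
  calc (d * Real.exp (-(p * Real.log d)) - c * Real.exp (-(p * Real.log c))) / (1 - p) *
        (Real.exp (p * θ) * Real.exp (-p))
      ≤ ((d - c) * Real.exp (-(p * θ))) / (1 - p) * (Real.exp (p * θ) * Real.exp (-p)) := by
        gcongr
        linarith
    _ = (Real.exp (-(p * θ)) * Real.exp (p * θ)) * (Real.exp (-p) / (1 - p) * (d - c)) := by ring
    _ = _ := by rw [e2, one_mul]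

end PowerWeight

/-! ### Translation to the A_∞ characteristic, and the extremal weights. -/

section Characteristic

variable {φ : ℝ → ℝ} {a b K : ℝ}

theorem setAverage_Icc_eq (f : ℝ → ℝ) {c d : ℝ} (hcd : c < d) :
    ⨍ t in Icc c d, f t = (∫ t in c..d, f t) / (d - c) := by
  rw [setAverage_eq, integral_Icc_eq_integral_Ioc, ← intervalIntegral.integral_of_le hcd.le,
    Real.volume_real_Icc_of_le hcd.le, smul_eq_mul, inv_mul_eq_div]

theorem ainfChar_exp_le_iff (hK : 0 ≤ K) :
    ainfChar (fun t => Real.exp (φ t)) a b ≤ ENNReal.ofReal K ↔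
      ∀ c d, a ≤ c → c < d → d ≤ b →
        (∫ t in c..d, Real.exp (φ t)) * Real.exp (-((∫ t in c..d, φ t) / (d - c))) ≤
          K * (d - c) := by
  simp only [ainfChar, iSup_le_iff, Real.log_exp, ENNReal.ofReal_le_ofReal_iff hK, and_imp]
  refine forall₅_congr fun c d _ hcd _ => ?_
  have hdc : 0 < d - c := by linarith
  rw [setAverage_Icc_eq _ hcd, setAverage_Icc_eq _ hcd, div_mul_eq_mul_div, div_le_iff₀ hdc]

theorem le_ainfChar_exp {c d : ℝ} (hc : a ≤ c) (hcd : c < d) (hd : d ≤ b)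
    (h : K * (d - c) ≤
      (∫ t in c..d, Real.exp (φ t)) * Real.exp (-((∫ t in c..d, φ t) / (d - c)))) :
    ENNReal.ofReal K ≤ ainfChar (fun t => Real.exp (φ t)) a b := by
  have hdc : 0 < d - c := by linarith
  refine le_trans ?_ (le_iSup_of_le c (le_iSup_of_le d (le_iSup_of_le ⟨hc, hcd, hd⟩ le_rfl)))
  simp only [Real.log_exp]
  apply ENNReal.ofReal_le_ofReal
  rwa [setAverage_Icc_eq _ hcd, setAverage_Icc_eq _ hcd, div_mul_eq_mul_div, le_div_iff₀ hdc]

theorem memAinf_exp (hφ : IntegrableOn φ (Icc a b))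
    (hexp : IntegrableOn (fun t => Real.exp (φ t)) (Icc a b))
    (hK : ainfChar (fun t => Real.exp (φ t)) a b ≤ ENNReal.ofReal K) :
    MemAinf (fun t => Real.exp (φ t)) a b where
  ae_pos := Filter.Eventually.of_forall fun _ => Real.exp_pos _
  integrableOn := hexp
  integrableOn_log := by simpa only [Real.log_exp] using hφ
  char_lt_top := hK.trans_lt ENNReal.ofReal_lt_top

theorem integrableOn_Icc_iff_intervalIntegrable {f : ℝ → ℝ} (hab : a ≤ b) :
    IntegrableOn f (Icc a b) ↔ IntervalIntegrable f volume a b := by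
  rw [integrableOn_Icc_iff_integrableOn_Ioc, intervalIntegrable_iff_integrableOn_Ioc_of_le hab]

/-- The power weights `(t - a)^{-p}` with `p < 1` have characteristic `e^{-p} / (1 - p)`. -/
theorem memAinf_powerWeight {p : ℝ} (hp : p < 1) (hab : a < b) :
    MemAinf (fun t => Real.exp (-(p * Real.log (t - a)))) a b ∧
      ainfChar (fun t => Real.exp (-(p * Real.log (t - a)))) a b =
        ENNReal.ofReal (Real.exp (-p) / (1 - p)) := by
  have hK : 0 ≤ Real.exp (-p) / (1 - p) := div_nonneg (Real.exp_pos _).le (by linarith)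
  have hle : ainfChar (fun t => Real.exp (-(p * Real.log (t - a)))) a b ≤
      ENNReal.ofReal (Real.exp (-p) / (1 - p)) := by
    rw [ainfChar_exp_le_iff hK]
    intro c d hc hcd hd
    rw [intervalIntegral.integral_comp_sub_right (fun u => Real.exp (-(p * Real.log u))),
      intervalIntegral.integral_comp_sub_right (fun u => -(p * Real.log u))]
    have := integral_exp_mul_exp_neg_le hp (sub_nonneg.2 hc) (sub_lt_sub_right hcd a)
    rwa [sub_sub_sub_cancel_right] at this
  refine ⟨memAinf_exp ?_ ?_ hle, hle.antisymm (le_ainfChar_exp le_rfl hab le_rfl ?_)⟩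
  · rw [integrableOn_Icc_iff_intervalIntegrable hab.le]
    have := (intervalIntegral.intervalIntegrable_log' (a := 0) (b := b - a)).comp_sub_right a
    simp only [zero_add, sub_add_cancel] at this
    exact (this.const_mul p).neg
  · rw [integrableOn_Icc_iff_intervalIntegrable hab.le]
    have := (intervalIntegrable_exp_neg_mul_log hp le_rfl (sub_pos.2 hab)).comp_sub_right a
    simpa only [zero_add, sub_add_cancel] using this
  · rw [intervalIntegral.integral_comp_sub_right (fun u => Real.exp (-(p * Real.log u))),
      intervalIntegral.integral_comp_sub_right (fun u => -(p * Real.log u))]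
    have := integral_exp_mul_exp_neg_eq hp (sub_pos.2 hab)
    rw [sub_self]
    rw [sub_zero] at this
    exact this.ge

theorem not_memAinf_powerWeight {p : ℝ} (hp : 1 ≤ p) (hab : a < b) :
    ¬ MemAinf (fun t => Real.exp (-(p * Real.log (t - a)))) a b := by
  intro h
  have h1 := (integrableOn_Icc_iff_intervalIntegrable hab.le).1 h.integrableOn
  have h2 := h1.comp_add_right a
  simp only [sub_self, add_sub_cancel_right] at h2
  rw [intervalIntegrable_iff_integrableOn_Ioo_of_le (sub_pos.2 hab).le] at h2
  have h3 : IntegrableOn (fun u : ℝ => u ^ (-p)) (Ioo 0 (b - a)) :=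
    h2.congr_fun (fun u hu => exp_neg_mul_log_eq_rpow p hu.1) measurableSet_Ioo
  rw [intervalIntegral.integrableOn_Ioo_rpow_iff (sub_pos.2 hab)] at h3
  linarith

theorem memAinfC_exp_mul {C ξ δ : ℝ} (h0 : 0 ≤ ξ) (h1 : ξ < 1)
    (hC : Real.exp (-ξ) = C * (1 - ξ)) (hC0 : 0 ≤ C) (hδ : 1 ≤ δ) (h : δ * ξ < 1) (hab : a < b)
    (hφ : MemAinfC C (fun t => Real.exp (φ t)) a b) :
    MemAinf (fun t => Real.exp (δ * φ t)) a b ∧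
      ainfChar (fun t => Real.exp (δ * φ t)) a b ≤
        ENNReal.ofReal (Real.exp (-(δ * ξ)) / (1 - δ * ξ)) := by
  -- The main argument divides by δ - 1; for δ = 1 the bound is C itself.
  rcases eq_or_lt_of_le hδ with rfl | hδ
  · have : 1 - ξ ≠ 0 := by linarith
    have e : Real.exp (-ξ) / (1 - ξ) = C := by rw [hC]; field_simp
    simp only [one_mul, e]
    exact hφ
  have hφI := hφ.1.integrableOn_log
  simp only [Real.log_exp] at hφI
  have hexpI := hφ.1.integrableOn
  have hJ := (ainfChar_exp_le_iff hC0).1 hφ.2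
  have key : ∀ c d, a ≤ c → c < d → d ≤ b → _ := fun c d hc hcd hd =>
    integrable_exp_mul_and_integral_mul_le (φ := φ) hδ h h0 h1 hC hcd
      ((integrableOn_Icc_iff_intervalIntegrable hcd.le).1 (hφI.mono_set (Icc_subset_Icc hc hd)))
      ((integrableOn_Icc_iff_intervalIntegrable hcd.le).1 (hexpI.mono_set (Icc_subset_Icc hc hd)))
      (fun c' d' hc' hcd' hd' => hJ c' d' (hc.trans hc') hcd' (hd'.trans hd))
  have hle : ainfChar (fun t => Real.exp (δ * φ t)) a b ≤
      ENNReal.ofReal (Real.exp (-(δ * ξ)) / (1 - δ * ξ)) := by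
    rw [ainfChar_exp_le_iff (div_nonneg (Real.exp_pos _).le (by linarith))]
    exact fun c d hc hcd hd => (key c d hc hcd hd).2
  exact ⟨memAinf_exp (hφI.const_mul δ)
    ((integrableOn_Icc_iff_intervalIntegrable hab.le).2 (key a b le_rfl hab le_rfl).1) hle, hle⟩

end Characteristic

theorem mainTheorem7 (C : ℝ) (hC : 1 ≤ C) (a b : ℝ) (hab : a < b) (δ : ℝ) (hδ : 1 ≤ δ) :
    -- the self-improvement estimate for `1 ≤ δ < 1 / ξ⁺(C)`, and its sharpness
    (δ * xiPlus C hC < 1 →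
      (∀ φ : ℝ → ℝ, MemAinfC C (fun t => Real.exp (φ t)) a b →
        MemAinf (fun t => Real.exp (δ * φ t)) a b ∧
        ainfChar (fun t => Real.exp (δ * φ t)) a b ≤
          ENNReal.ofReal (Real.exp (-(δ * xiPlus C hC)) / (1 - δ * xiPlus C hC))) ∧
      (∃ φ : ℝ → ℝ, MemAinfC C (fun t => Real.exp (φ t)) a b ∧
        ainfChar (fun t => Real.exp (δ * φ t)) a b =
          ENNReal.ofReal (Real.exp (-(δ * xiPlus C hC)) / (1 - δ * xiPlus C hC)))) ∧
    -- the range of `δ` is sharp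
    (1 ≤ δ * xiPlus C hC →
      ∃ φ : ℝ → ℝ, MemAinfC C (fun t => Real.exp (φ t)) a b ∧
        ¬ MemAinf (fun t => Real.exp (δ * φ t)) a b) := by

  obtain ⟨h0, h1, hξ⟩ := xiPlus_spec C hC
  set ξ := xiPlus C hC
  have hC0 : 0 ≤ C := by linarith
  have h1' : 1 - ξ ≠ 0 := by linarith
  have e : Real.exp (-ξ) / (1 - ξ) = C := by rw [hξ]; field_simp
  -- The weight (t-a)^{-ξ} serves both sharpness claims: its characteristic is e^{-ξ}/(1-ξ) = C.
  obtain ⟨hmem, hchar⟩ := memAinf_powerWeight h1 hab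
  rw [e] at hchar
  have hδφ : (fun t => Real.exp (δ * -(ξ * Real.log (t - a)))) =
      fun t => Real.exp (-(δ * ξ * Real.log (t - a))) := by
    funext t; congr 1; ring
  refine ⟨fun h => ⟨fun φ hφ => memAinfC_exp_mul h0 h1 hξ hC0 hδ h hab hφ,
    fun t => -(ξ * Real.log (t - a)), ⟨hmem, hchar.le⟩, ?_⟩,
    fun h => ⟨fun t => -(ξ * Real.log (t - a)), ⟨hmem, hchar.le⟩, ?_⟩⟩
  · rw [hδφ]
    exact (memAinf_powerWeight h hab).2
  · rw [hδφ]
    exact not_memAinf_powerWeight h hab
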